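/- Let $R$ be an associative ring with unit. An $\mathcal R$-module is a covariant additive functor $\mathbb M$ from left $R$-modules to abelian groups. For a right $R$-module $N$ let $\mathcal N$ be the quasi-coherent $\mathcal R$-module $\mathcal N(S)=N\otimes_R S$, and let $\mathbb M^*$ be the functor $N\mapsto \operatorname{Hom}_{\mathcal R}(\mathbb M,\mathcal N)$ (natural transformations) on right $R$-modules. Let $\langle\text{Qs-ch}\rangle$ be the class of $\mathcal R$-modules $\mathbb M$ that preserve direct limits. Such an $\mathbb M$ is called - an FP module if the natural map $\mathbb M(\prod_{i\in I} S_i)\to\prod_{i\in I}\mathbb M(S_i)$ is an isomorphism for every set $\{S_i\}_{i\in I}$ of left $R$-modules; - an ML module if this natural map is injective for every set $\{S_i\}_{i\in I}$ of left $R$-modules; - an SML module if it is an ML module and, for every FP submodule $\mathbb F\subseteq\mathbb M$, the dual morphism $\mathbb M^*\to\mathbb F^*$ is an epimorphism. A module $M$ is called strict Mittag-Leffler if for every finitely generated submodule $i\colon N\hookrightarrow M$ there exist a finitely presented module $P$ and homomorphisms $f\colon M\to P$, $g\colon P\to M$ such that $g\circ f\circ i=i$. An injective homomorphism $M\to M'$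 of right $R$-modules is called pure if $M\otimes_R S\to M'\otimes_R S$ is injective for every left $R$-module $S$. **Theorem.** Let $M$ be a right $R$-module. Then $M$ is strict Mittag-Leffler if and only if $\mathcal M$ is an SML module. In particular, if $M$ is strict Mittag-Leffler, then there are a set $J$, finitely presented right $R$-modules $P_j$ ($j\in J$) and a pure injective homomorphism $M\to\prod_{j\in J}P_j$; that is, $M$ is isomorphic to a pure submodule of a product of finitely presented modules. -/

import Mathlib

open CategoryTheory CategoryTheory.Limits Opposite
open scoped TensorProduct

universe u

/-! ### The tensor product `M ⊗_R S` over a (not necessarily commutative) ring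

A right `R`-module is a `Module Rᵐᵒᵖ M`, so that `m · r` is `MulOpposite.op r • m`. -/

section Tensor

variable (R : Type u) [Ring R]

/-- The subgroup of `M ⊗_ℤ S` generated by all `(m · r) ⊗ s - m ⊗ (r s)`. -/
def balancedRelations (M S : Type u) [AddCommGroup M] [Module Rᵐᵒᵖ M]
    [AddCommGroup S] [Module R S] : AddSubgroup (M ⊗[ℤ] S) :=
  AddSubgroup.closure
    {x | ∃ (m : M) (r : R) (s : S), x = (MulOpposite.op r • m) ⊗ₜ[ℤ] s - m ⊗ₜ[ℤ] (r • s)}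

/-- `M ⊗_R S`, for a right `R`-module `M` and a left `R`-module `S`: an abelian group. -/
abbrev BalancedTensor (M S : Type u) [AddCommGroup M] [Module Rᵐᵒᵖ M]
    [AddCommGroup S] [Module R S] : Type u :=
  (M ⊗[ℤ] S) ⧸ balancedRelations R M S

variable {M M' M'' : Type u} [AddCommGroup M] [Module Rᵐᵒᵖ M]
  [AddCommGroup M'] [Module Rᵐᵒᵖ M'] [AddCommGroup M''] [Module Rᵐᵒᵖ M'']
  {S S' S'' : Type u} [AddCommGroup S] [Module R S] [AddCommGroup S'] [Module R S']
  [AddCommGroup S''] [Module R S'']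

/-- The pure tensor `m ⊗ s` in `M ⊗_R S`. -/
def BalancedTensor.tmul (m : M) (s : S) : BalancedTensor R M S :=
  QuotientAddGroup.mk (m ⊗ₜ[ℤ] s)

theorem BalancedTensor.tmul_balanced (m : M) (r : R) (s : S) :
    BalancedTensor.tmul R (MulOpposite.op r • m) s = BalancedTensor.tmul R m (r • s) := by
  refine (QuotientAddGroup.eq_iff_sub_mem).2 ?_
  exact AddSubgroup.subset_closure ⟨m, r, s, rfl⟩

/-- The map `f ⊗ g : M ⊗_R S → M' ⊗_R S'`. -/
def BalancedTensor.map (f : M →ₗ[Rᵐᵒᵖ] M') (g : S →ₗ[R] S') :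
    BalancedTensor R M S →+ BalancedTensor R M' S' :=
  QuotientAddGroup.map (balancedRelations R M S) (balancedRelations R M' S')
    (TensorProduct.map f.toAddMonoidHom.toIntLinearMap
      g.toAddMonoidHom.toIntLinearMap).toAddMonoidHom (by
    refine (AddSubgroup.closure_le _).2 ?_
    rintro _ ⟨m, r, s, rfl⟩
    refine AddSubgroup.subset_closure ⟨f m, r, g s, ?_⟩
    simp)

@[simp]
theorem BalancedTensor.map_tmul (f : M →ₗ[Rᵐᵒᵖ] M') (g : S →ₗ[R] S') (m : M) (s : S) :
    BalancedTensor.map R f g (BalancedTensor.tmul R m s) =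
      BalancedTensor.tmul R (f m) (g s) := rfl

/-- Additive maps out of `M ⊗_R S` are determined by their values on pure tensors. -/
theorem BalancedTensor.addHom_ext {A : Type*} [AddCommGroup A]
    {f g : BalancedTensor R M S →+ A}
    (h : ∀ m s, f (BalancedTensor.tmul R m s) = g (BalancedTensor.tmul R m s)) : f = g := by
  refine QuotientAddGroup.addMonoidHom_ext _ ?_
  refine AddMonoidHom.toIntLinearMap_injective ?_
  refine TensorProduct.ext' fun m s => ?_
  exact h m s

theorem BalancedTensor.map_id :
    BalancedTensor.map R (LinearMap.id : M →ₗ[Rᵐᵒᵖ] M) (LinearMap.id : S →ₗ[R] S) =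
      AddMonoidHom.id _ :=
  BalancedTensor.addHom_ext R fun _ _ => rfl

theorem BalancedTensor.map_comp (f : M →ₗ[Rᵐᵒᵖ] M') (f' : M' →ₗ[Rᵐᵒᵖ] M'')
    (g : S →ₗ[R] S') (g' : S' →ₗ[R] S'') :
    BalancedTensor.map R (f'.comp f) (g'.comp g) =
      (BalancedTensor.map R f' g').comp (BalancedTensor.map R f g) :=
  BalancedTensor.addHom_ext R fun _ _ => rfl

theorem BalancedTensor.map_add_right (f : M →ₗ[Rᵐᵒᵖ] M') (g h : S →ₗ[R] S') :
    BalancedTensor.map R f (g + h) = BalancedTensor.map R f g + BalancedTensor.map R f h :=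
  BalancedTensor.addHom_ext R fun m s =>
    congrArg (QuotientAddGroup.mk (s := balancedRelations R M' S'))
      (TensorProduct.tmul_add (R := ℤ) (f m) (g s) (h s))

end Tensor

/-! ### `𝓡`-modules -/

section Functors

variable {R : Type u} [Ring R]

/-- The quasi-coherent `𝓡`-module `S ↦ M ⊗_R S` of a right `R`-module `M`. -/
noncomputable def quasiCoherent (M : ModuleCat.{u} Rᵐᵒᵖ) :
    ModuleCat.{u} R ⥤ AddCommGrpCat.{u} where
  obj S := AddCommGrpCat.of (BalancedTensor R M S)
  map g := AddCommGrpCat.ofHom (BalancedTensor.map R LinearMap.id g.hom)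
  map_id S := by
    ext1
    exact BalancedTensor.map_id R
  map_comp g g' := by
    ext1
    exact BalancedTensor.map_comp R LinearMap.id LinearMap.id g.hom g'.hom

instance (M : ModuleCat.{u} Rᵐᵒᵖ) : (quasiCoherent M).Additive where
  map_add {_ _ g h} := by
    ext1
    exact BalancedTensor.map_add_right R LinearMap.id g.hom h.hom

variable (R) in
/-- `M ↦ 𝓜` as a functor from right `R`-modules to functors on left `R`-modules. -/
noncomputable def quasiCoherentFunctor :
    ModuleCat.{u} Rᵐᵒᵖ ⥤ (ModuleCat.{u} R ⥤ AddCommGrpCat.{u}) where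
  obj M := quasiCoherent M
  map f :=
    { app := fun S => AddCommGrpCat.ofHom (BalancedTensor.map R f.hom LinearMap.id)
      naturality := fun S S' g => by
        ext1
        exact BalancedTensor.addHom_ext R fun _ _ => rfl }
  map_id M := by
    ext S : 2
    ext1
    exact BalancedTensor.map_id R
  map_comp f f' := by
    ext S : 2
    ext1
    exact BalancedTensor.map_comp R f.hom f'.hom LinearMap.id LinearMap.id

/-- The dual `𝕄* : N ↦ Hom_𝓡(𝕄, 𝓝)`, a functor on right `R`-modules. (Groups of natural
transformations live one universe higher.) -/
noncomputable def dualModule (F : ModuleCat.{u} R ⥤ AddCommGrpCat.{u}) :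
    ModuleCat.{u} Rᵐᵒᵖ ⥤ AddCommGrpCat.{u + 1} :=
  quasiCoherentFunctor R ⋙ preadditiveCoyoneda.obj (op F)

/-- The dual morphism `𝕄* ⟶ 𝔽*` of `𝔽 ⟶ 𝕄`, given by precomposition. -/
noncomputable def dualMap {F G : ModuleCat.{u} R ⥤ AddCommGrpCat.{u}} (i : F ⟶ G) :
    dualModule G ⟶ dualModule F :=
  Functor.whiskerLeft (quasiCoherentFunctor R) (preadditiveCoyoneda.map i.op)

/-- Membership in `⟨Qs-ch⟩`: an additive functor from left `R`-modules to abelian groups that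
preserves direct limits (colimits of systems indexed by upward directed sets). -/
structure IsQsCh (F : ModuleCat.{u} R ⥤ AddCommGrpCat.{u}) : Prop where
  additive : F.Additive
  preservesDirectLimits : ∀ (I : Type u) [Preorder I] [IsDirectedOrder I] [Nonempty I],
    PreservesColimitsOfShape I F

/-- The natural map `𝕄(∏ i, S i) → ∏ i, 𝕄(S i)`. -/
def prodComparisonMap (F : ModuleCat.{u} R ⥤ AddCommGrpCat.{u}) {I : Type u}
    (S : I → ModuleCat.{u} R) :
    F.obj (ModuleCat.of R (∀ i, S i)) →+ ∀ i, F.obj (S i) :=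
  AddMonoidHom.pi fun i =>
    (F.map (ModuleCat.ofHom (LinearMap.proj i : (∀ i, S i) →ₗ[R] S i))).hom

/-- FP modules: objects of `⟨Qs-ch⟩` that preserve direct products. -/
structure IsFPFunctor (F : ModuleCat.{u} R ⥤ AddCommGrpCat.{u}) : Prop where
  isQsCh : IsQsCh F
  bijective : ∀ (I : Type u) (S : I → ModuleCat.{u} R),
    Function.Bijective (prodComparisonMap F S)

/-- ML modules. -/
structure IsMLFunctor (F : ModuleCat.{u} R ⥤ AddCommGrpCat.{u}) : Prop where
  isQsCh : IsQsCh F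
  injective : ∀ (I : Type u) (S : I → ModuleCat.{u} R),
    Function.Injective (prodComparisonMap F S)

/-- SML modules: ML modules `𝕄` such that `𝕄* ⟶ 𝔽*` is an epimorphism for every
FP submodule `𝔽 ⊆ 𝕄`. -/
structure IsSMLFunctor (F : ModuleCat.{u} R ⥤ AddCommGrpCat.{u}) : Prop where
  isML : IsMLFunctor F
  epi_dual : ∀ (G : ModuleCat.{u} R ⥤ AddCommGrpCat.{u}) (i : G ⟶ F),
    IsFPFunctor G → Mono i → Epi (dualMap i)

end Functors

/-! ### Modules -/

/-- Strict Mittag-Leffler modules (over `A`; take `A = Rᵐᵒᵖ` for right `R`-modules): for every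
finitely generated submodule `N` there are a finitely presented module `P` and maps
`f : M → P`, `g : P → M` with `g ∘ f` the identity on `N`. -/
def IsStrictMittagLeffler (A : Type u) [Ring A] (M : Type u) [AddCommGroup M] [Module A M] :
    Prop :=
  ∀ N : Submodule A M, N.FG → ∃ (P : ModuleCat.{u} A) (f : M →ₗ[A] P) (g : P →ₗ[A] M),
    Module.FinitePresentation A P ∧ g.comp (f.comp N.subtype) = N.subtype

/-- Pure monomorphisms of right `R`-modules: `f ⊗ S` is injective for every left `R`-module `S`
(in particular, for `S = R`, so is `f`). -/
def IsPureMono (R : Type u) [Ring R] {M M' : Type u} [AddCommGroup M] [Module Rᵐᵒᵖ M]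
    [AddCommGroup M'] [Module Rᵐᵒᵖ M'] (f : M →ₗ[Rᵐᵒᵖ] M') : Prop :=
  ∀ S : ModuleCat.{u} R,
    Function.Injective (BalancedTensor.map R f (LinearMap.id : S →ₗ[R] S))

/-!
Write `x ∈ M ⊗_R A` for an element of the value at `A` of the quasi-coherent functor `𝓜` of `M`,
and `⟨x⟩ ⊆ 𝓜` for the subfunctor it generates.

Let `𝓜` be an SML module and `N ⊆ M` the image of a homomorphism from a free module of rank `n`,
encoded as an element `x ∈ M ⊗_R Rⁿ`. Because `𝓜` is ML, some lift `y ∈ P ⊗_R Rⁿ` of `x` along a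
homomorphism `g : P → M` from a finitely presented module satisfies the same linear relations as
`x`, so that `x ↦ y` defines a morphism `⟨x⟩ ⟶ 𝓟`. Because `⟨x⟩` is an FP module, this morphism
extends to `𝓜 ⟶ 𝓟`, which is induced by a homomorphism `f : M → P`; then `g ∘ f` fixes `N`.

Conversely, let `M` be strict Mittag-Leffler. Every `x ∈ M ⊗_R A` is fixed by some `g ∘ f` through a
finitely presented module `P`, and `𝓟` preserves products; hence `𝓜` is ML. An FP submodule of `𝓜`
is of the form `⟨x⟩`, and a morphism `⟨x⟩ ⟶ 𝓝` sends `x` to an element that satisfies all relations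
of `f(x) ∈ P ⊗_R A`. Testing this on the pushout of `A` along the transpose of a presentation of `P`
produces `φ : P → N` such that `φ ∘ f` induces an extension `𝓜 ⟶ 𝓝`.
-/

theorem exists_comp_eq_on_of_fg {K F : Type*} [Ring K] [AddCommGroup F] [Module K F]
    [Module.Free K F] {N : Submodule K F} (hN : N.FG) :
    ∃ (n : ℕ) (r : F →ₗ[K] (Fin n → K)) (s : (Fin n → K) →ₗ[K] F), ∀ v ∈ N, s (r v) = v := by
  classical
  obtain ⟨t, rfl⟩ := hN
  let b := Module.Free.chooseBasis K F
  let T := t.biUnion fun v => (b.repr v).support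
  let e := T.equivFin.symm
  let r : F →ₗ[K] (Fin T.card → K) := LinearMap.pi fun i => b.coord (e i)
  let s := Fintype.linearCombination K fun i => b (e i)
  refine ⟨T.card, r, s, fun v hv => ?_⟩
  suffices h : Submodule.span K t ≤ LinearMap.eqLocus (s ∘ₗ r) .id from h hv
  refine Submodule.span_le.2 fun v hv => ?_
  have hvT : (b.repr v).support ⊆ T :=
    Finset.subset_biUnion_of_mem (fun v => (b.repr v).support) hv
  calc s (r v) = ∑ i, b.repr v (e i) • b (e i) := rfl
    _ = ∑ x : T, b.repr v x • b x := e.sum_comp fun x : T => b.repr v x • b x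
    _ = ∑ x ∈ T, b.repr v x • b x := T.sum_coe_sort fun x => b.repr v x • b x
    _ = v := by
      rw [← Finsupp.sum_of_support_subset (b.repr v) hvT (fun x a => a • b x) (by simp),
        ← Finsupp.linearCombination_apply, b.linearCombination_repr]

namespace BalancedTensor

variable {R : Type u} [Ring R]
  {M M' M'' N P : Type u} [AddCommGroup M] [Module Rᵐᵒᵖ M] [AddCommGroup M'] [Module Rᵐᵒᵖ M']
  [AddCommGroup M''] [Module Rᵐᵒᵖ M''] [AddCommGroup N] [Module Rᵐᵒᵖ N]
  [AddCommGroup P] [Module Rᵐᵒᵖ P]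
  {S S' S'' A : Type u} [AddCommGroup S] [Module R S] [AddCommGroup S'] [Module R S']
  [AddCommGroup S''] [Module R S''] [AddCommGroup A] [Module R A]

variable (R M S) in
/-- The universal balanced biadditive map `(m, s) ↦ m ⊗ s`. -/
def tmulHom : M →+ S →+ BalancedTensor R M S :=
  AddMonoidHom.mk' (fun m => AddMonoidHom.mk' (tmul R m) fun s t =>
      congrArg (QuotientAddGroup.mk (s := balancedRelations R M S)) (TensorProduct.tmul_add m s t))
    fun m m' => AddMonoidHom.ext fun s =>
      congrArg (QuotientAddGroup.mk (s := balancedRelations R M S)) (TensorProduct.add_tmul m m' s)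

theorem sum_tmul {ι : Type*} (t : Finset ι) (m : ι → M) (s : S) :
    tmul R (∑ i ∈ t, m i) s = ∑ i ∈ t, tmul R (m i) s :=
  map_sum ((tmulHom R M S).flip s) m t

theorem tmul_sum {ι : Type*} (t : Finset ι) (m : M) (s : ι → S) :
    tmul R m (∑ i ∈ t, s i) = ∑ i ∈ t, tmul R m (s i) :=
  map_sum (tmulHom R M S m) s t

@[elab_as_elim]
theorem induction_on {p : BalancedTensor R M S → Prop} (x : BalancedTensor R M S)
    (tmul : ∀ m s, p (tmul R m s)) (add : ∀ x y, p x → p y → p (x + y)) : p x := by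
  obtain ⟨x, rfl⟩ := QuotientAddGroup.mk_surjective x
  induction x using TensorProduct.induction_on with
  | zero => simpa [BalancedTensor.tmul] using tmul 0 0
  | tmul m s => exact tmul m s
  | add x y hx hy => exact add _ _ hx hy

/-- The additive map out of `M ⊗_R S` induced by a balanced biadditive map. -/
def lift {B : Type*} [AddCommGroup B] (f : M →+ S →+ B)
    (hf : ∀ (m : M) (r : R) (s : S), f (MulOpposite.op r • m) s = f m (r • s)) :
    BalancedTensor R M S →+ B :=
  QuotientAddGroup.lift _ (TensorProduct.liftAddHom (R := ℤ) f fun n m s => by simp) (by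
    refine (AddSubgroup.closure_le _).2 ?_
    rintro _ ⟨m, r, s, rfl⟩
    simp [AddMonoidHom.mem_ker, hf])

theorem map_id_apply (x : BalancedTensor R M S) : map R .id .id x = x :=
  DFunLike.congr_fun (map_id R) x

theorem map_map (f : M →ₗ[Rᵐᵒᵖ] M') (f' : M' →ₗ[Rᵐᵒᵖ] M'') (g : S →ₗ[R] S') (g' : S' →ₗ[R] S'')
    (x : BalancedTensor R M S) :
    map R f' g' (map R f g x) = map R (f' ∘ₗ f) (g' ∘ₗ g) x :=
  (DFunLike.congr_fun (map_comp R f f' g g') x).symm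

theorem map_comm (f : M →ₗ[Rᵐᵒᵖ] M') (g : S →ₗ[R] S') (x : BalancedTensor R M S) :
    map R .id g (map R f .id x) = map R f .id (map R .id g x) := by
  rw [map_map, map_map]
  rfl

theorem map_zero_left (g : S →ₗ[R] S') : map R (0 : M →ₗ[Rᵐᵒᵖ] M') g = 0 :=
  addHom_ext R fun _ s => map_zero ((tmulHom R M' S').flip (g s))

theorem map_zero_right (f : M →ₗ[Rᵐᵒᵖ] M') : map R f (0 : S →ₗ[R] S') = 0 :=
  addHom_ext R fun m _ => map_zero (tmulHom R M' S' (f m))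

theorem map_add_left (f g : M →ₗ[Rᵐᵒᵖ] M') (h : S →ₗ[R] S') :
    map R (f + g) h = map R f h + map R g h :=
  addHom_ext R fun m s => map_add ((tmulHom R M' S').flip (h s)) (f m) (g m)

theorem map_surjective {f : M →ₗ[Rᵐᵒᵖ] M'} {g : S →ₗ[R] S'} (hf : Function.Surjective f)
    (hg : Function.Surjective g) : Function.Surjective (map R f g) := fun x => by
  induction x using induction_on with
  | tmul m s =>
    obtain ⟨m, rfl⟩ := hf m
    obtain ⟨s, rfl⟩ := hg s
    exact ⟨tmul R m s, rfl⟩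
  | add x y hx hy =>
    obtain ⟨x, rfl⟩ := hx
    obtain ⟨y, rfl⟩ := hy
    exact ⟨x + y, map_add _ x y⟩

theorem map_exact_left {f : M →ₗ[Rᵐᵒᵖ] M'} {g : M' →ₗ[Rᵐᵒᵖ] M''} (hfg : Function.Exact f g)
    (hg : Function.Surjective g) :
    Function.Exact (map R f (.id : S →ₗ[R] S)) (map R g (.id : S →ₗ[R] S)) := by
  refine fun x => ⟨fun hx => ?_, ?_⟩
  · let q := QuotientAddGroup.mk' (map R f (.id : S →ₗ[R] S)).range
    let β : M' →+ S →+ _ := (AddMonoidHom.compHom q).comp (tmulHom R M' S)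
    let β' : M'' →+ S →+ _ := g.toAddMonoidHom.liftOfSurjective hg ⟨β, fun m hm => by
      obtain ⟨m, rfl⟩ := (hfg m).1 hm
      ext s
      exact (QuotientAddGroup.eq_zero_iff _).2 ⟨tmul R m s, rfl⟩⟩
    have hβ' (m : M') : β' (g m) = β m := AddMonoidHom.liftOfRightInverse_comp_apply ..
    let ψ := lift β' (R := R) fun m r s => by
      obtain ⟨m, rfl⟩ := hg m
      rw [← map_smul, hβ', hβ']
      exact congrArg q (tmul_balanced R m r s)
    have hψ : ψ.comp (map R g .id) = q := addHom_ext R fun m s => DFunLike.congr_fun (hβ' m) s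
    exact (QuotientAddGroup.eq_zero_iff x).1 <|
      (DFunLike.congr_fun hψ x).symm.trans ((congrArg ψ hx).trans (map_zero ψ))
  · rintro ⟨x, rfl⟩
    rw [map_map, hfg.linearMap_comp_eq_zero, map_zero_left, AddMonoidHom.zero_apply]

theorem map_exact_right {f : S →ₗ[R] S'} {g : S' →ₗ[R] S''} (hfg : Function.Exact f g)
    (hg : Function.Surjective g) :
    Function.Exact (map R (.id : M →ₗ[Rᵐᵒᵖ] M) f) (map R (.id : M →ₗ[Rᵐᵒᵖ] M) g) := by
  refine fun x => ⟨fun hx => ?_, ?_⟩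
  · let q := QuotientAddGroup.mk' (map R (.id : M →ₗ[Rᵐᵒᵖ] M) f).range
    let β : S' →+ M →+ _ := (AddMonoidHom.compHom q).comp (tmulHom R M S').flip
    let β' : S'' →+ M →+ _ := g.toAddMonoidHom.liftOfSurjective hg ⟨β, fun s hs => by
      obtain ⟨s, rfl⟩ := (hfg s).1 hs
      ext m
      exact (QuotientAddGroup.eq_zero_iff _).2 ⟨tmul R m s, rfl⟩⟩
    have hβ' (s : S') : β' (g s) = β s := AddMonoidHom.liftOfRightInverse_comp_apply ..
    let ψ := lift β'.flip (R := R) fun m r s => by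
      obtain ⟨s, rfl⟩ := hg s
      rw [AddMonoidHom.flip_apply, AddMonoidHom.flip_apply, ← map_smul, hβ', hβ']
      exact congrArg q (tmul_balanced R m r s)
    have hψ : ψ.comp (map R .id g) = q := addHom_ext R fun m s => DFunLike.congr_fun (hβ' s) m
    exact (QuotientAddGroup.eq_zero_iff x).1 <|
      (DFunLike.congr_fun hψ x).symm.trans ((congrArg ψ hx).trans (map_zero ψ))
  · rintro ⟨x, rfl⟩
    rw [map_map, hfg.linearMap_comp_eq_zero, map_zero_right, AddMonoidHom.zero_apply]

/-- The canonical isomorphism `M ⊗_R R → M`, `m ⊗ r ↦ m · r`, as an additive map. -/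
def rid : BalancedTensor R M R →+ M :=
  lift (AddMonoidHom.mk' (fun m => AddMonoidHom.mk' (fun r => MulOpposite.op r • m)
      fun r r' => by simp [add_smul]) fun m m' => by ext; simp)
    fun m r r' => by simp [mul_smul]

@[simp]
theorem rid_tmul (m : M) (r : R) : rid (tmul R m r) = MulOpposite.op r • m := rfl

/-- The canonical isomorphism `R ⊗_R S → S`, `r ⊗ s ↦ r • s`, as an additive map. -/
def lid : BalancedTensor R Rᵐᵒᵖ S →+ S :=
  lift (AddMonoidHom.mk' (fun r => AddMonoidHom.mk' (fun s => MulOpposite.unop r • s)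
      fun s s' => by simp) fun r r' => by ext; simp [add_smul])
    fun r r' s => by simp [mul_smul]

@[simp]
theorem lid_tmul (r : Rᵐᵒᵖ) (s : S) : lid (tmul R r s) = MulOpposite.unop r • s := rfl

section Coevaluation

variable {n : ℕ}

variable (R n) in
/-- The coevaluation `∑ i, eᵢ ⊗ eᵢ` of the duality between the free right and left modules of
rank `n`; it turns elements of tensor products into homomorphisms and back. -/
def coev : BalancedTensor R (Fin n → Rᵐᵒᵖ) (Fin n → R) :=
  ∑ i, tmul R (Pi.single i 1) (Pi.single i 1)

theorem map_coev (f : (Fin n → Rᵐᵒᵖ) →ₗ[Rᵐᵒᵖ] M) (g : (Fin n → R) →ₗ[R] S) :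
    map R f g (coev R n) = ∑ i, tmul R (f (Pi.single i 1)) (g (Pi.single i 1)) := by
  simp only [coev, map_sum, map_tmul]

theorem map_linearCombination_coev (m : Fin n → M) (s : Fin n → S) :
    map R (Fintype.linearCombination Rᵐᵒᵖ m) (Fintype.linearCombination R s) (coev R n) =
      ∑ i, tmul R (m i) (s i) := by
  simp [map_coev]

theorem exists_eq_map_coev (x : BalancedTensor R M S) :
    ∃ (n : ℕ) (f : (Fin n → Rᵐᵒᵖ) →ₗ[Rᵐᵒᵖ] M) (g : (Fin n → R) →ₗ[R] S),
      x = map R f g (coev R n) := by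
  suffices h : ∃ (n : ℕ) (m : Fin n → M) (s : Fin n → S), x = ∑ i, tmul R (m i) (s i) by
    obtain ⟨n, m, s, rfl⟩ := h
    exact ⟨n, _, _, (map_linearCombination_coev m s).symm⟩
  induction x using induction_on with
  | tmul m s => exact ⟨1, fun _ => m, fun _ => s, by simp⟩
  | add x y hx hy =>
    obtain ⟨n, m, s, rfl⟩ := hx
    obtain ⟨n', m', s', rfl⟩ := hy
    exact ⟨n + n', Fin.append m m', Fin.append s s', by simp [Fin.sum_univ_add]⟩

theorem map_id_coev_bijective :
    Function.Bijective fun g : (Fin n → R) →ₗ[R] S => map R .id g (coev R n) := by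
  refine ⟨fun g g' h => LinearMap.pi_ext' fun i => LinearMap.ext_ring ?_, fun x => ?_⟩
  · have hcoord (g : (Fin n → R) →ₗ[R] S) :
        lid (map R (.proj i) .id (map R .id g (coev R n))) = g (Pi.single i 1) := by
      rw [map_map, map_coev, map_sum, Finset.sum_eq_single i] <;> simp +contextual [eq_comm]
    simpa [hcoord] using congrArg (fun x => lid (map R (.proj i) .id x)) h
  · induction x using induction_on with
    | tmul v s =>
      refine ⟨Fintype.linearCombination R fun i => MulOpposite.unop (v i) • s, ?_⟩
      conv_rhs => rw [pi_eq_sum_univ' v, sum_tmul]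
      simp [map_coev, ← tmul_balanced]
    | add x y hx hy =>
      obtain ⟨⟨g, rfl⟩, g', rfl⟩ := hx, hy
      exact ⟨g + g', DFunLike.congr_fun (map_add_right R .id g g') _⟩

theorem map_coev_id_bijective :
    Function.Bijective fun f : (Fin n → Rᵐᵒᵖ) →ₗ[Rᵐᵒᵖ] M => map R f .id (coev R n) := by
  refine ⟨fun f f' h => LinearMap.pi_ext' fun i => LinearMap.ext_ring ?_, fun x => ?_⟩
  · have hcoord (f : (Fin n → Rᵐᵒᵖ) →ₗ[Rᵐᵒᵖ] M) :
        rid (map R .id (.proj i) (map R f .id (coev R n))) = f (Pi.single i 1) := by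
      rw [map_map, map_coev, map_sum, Finset.sum_eq_single i] <;> simp +contextual [eq_comm]
    simpa [hcoord] using congrArg (fun x => rid (map R .id (.proj i) x)) h
  · induction x using induction_on with
    | tmul m v =>
      refine ⟨Fintype.linearCombination Rᵐᵒᵖ fun i => MulOpposite.op (v i) • m, ?_⟩
      conv_rhs => rw [pi_eq_sum_univ' v, tmul_sum]
      simp [map_coev, tmul_balanced]
    | add x y hx hy =>
      obtain ⟨⟨f, rfl⟩, f', rfl⟩ := hx, hy
      exact ⟨f + f', DFunLike.congr_fun (map_add_left f f' .id) _⟩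

end Coevaluation

section FinitePresentation

variable {n r : ℕ} {π : (Fin n → Rᵐᵒᵖ) →ₗ[Rᵐᵒᵖ] P} {d : (Fin r → Rᵐᵒᵖ) →ₗ[Rᵐᵒᵖ] (Fin n → Rᵐᵒᵖ)}
  {dT : (Fin n → R) →ₗ[R] (Fin r → R)}

theorem exists_map_coev_eq_of_surjective (hπ : Function.Surjective π) (y : BalancedTensor R P S) :
    ∃ g : (Fin n → R) →ₗ[R] S, map R π g (coev R n) = y := by
  obtain ⟨x, rfl⟩ := map_surjective (R := R) (g := (.id : S →ₗ[R] S)) hπ (fun s => ⟨s, rfl⟩) y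
  obtain ⟨g, rfl⟩ := map_id_coev_bijective.2 x
  exact ⟨g, by rw [map_map, LinearMap.comp_id, LinearMap.id_comp]⟩

theorem exists_map_id_coev_eq_map_coev_id (d : (Fin r → Rᵐᵒᵖ) →ₗ[Rᵐᵒᵖ] (Fin n → Rᵐᵒᵖ)) :
    ∃ dT : (Fin n → R) →ₗ[R] (Fin r → R), map R .id dT (coev R n) = map R d .id (coev R r) :=
  map_id_coev_bijective.2 _

theorem map_comp_coev_eq (hdT : map R .id dT (coev R n) = map R d .id (coev R r))
    (f : (Fin n → Rᵐᵒᵖ) →ₗ[Rᵐᵒᵖ] M) (g : (Fin r → R) →ₗ[R] S) :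
    map R f (g ∘ₗ dT) (coev R n) = map R (f ∘ₗ d) g (coev R r) := by
  simpa only [map_map, LinearMap.comp_id] using congrArg (map R f g) hdT

theorem exists_eq_comp_of_map_coev_eq_zero (hπ : Function.Surjective π) (hd : Function.Exact d π)
    (hdT : map R .id dT (coev R n) = map R d .id (coev R r)) {g : (Fin n → R) →ₗ[R] S}
    (hg : map R π g (coev R n) = 0) : ∃ t : (Fin r → R) →ₗ[R] S, g = t ∘ₗ dT := by
  have h : map R π (.id : S →ₗ[R] S) (map R .id g (coev R n)) = 0 := by
    rwa [map_map]
  obtain ⟨y, hy⟩ := (map_exact_left hd hπ _).1 h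
  obtain ⟨t, rfl⟩ := map_id_coev_bijective.2 y
  refine ⟨t, map_id_coev_bijective.1 ?_⟩
  calc map R .id g (coev R n) = map R d .id (map R .id t (coev R r)) := hy.symm
    _ = map R d t (coev R r) := map_map ..
    _ = map R .id (t ∘ₗ dT) (coev R n) := (map_comp_coev_eq hdT .id t).symm

theorem eq_zero_of_map_proj_eq_zero [Module.FinitePresentation Rᵐᵒᵖ P] {I : Type u}
    {S : I → Type u} [∀ i, AddCommGroup (S i)] [∀ i, Module R (S i)]
    {y : BalancedTensor R P (∀ i, S i)} (hy : ∀ i, map R .id (.proj i) y = 0) : y = 0 := by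
  obtain ⟨n, r, π, d, hπ, hd⟩ := Module.FinitePresentation.exists_fin' Rᵐᵒᵖ P
  obtain ⟨dT, hdT⟩ := exists_map_id_coev_eq_map_coev_id d
  obtain ⟨g, rfl⟩ := exists_map_coev_eq_of_surjective hπ y
  have hfactor (i : I) : ∃ t : (Fin r → R) →ₗ[R] S i, .proj i ∘ₗ g = t ∘ₗ dT :=
    exists_eq_comp_of_map_coev_eq_zero hπ hd hdT (by rw [← hy i, map_map]; rfl)
  choose t ht using hfactor
  have hg : g = LinearMap.pi t ∘ₗ dT := LinearMap.ext fun v => funext fun i =>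
    LinearMap.congr_fun (ht i) v
  rw [hg, map_comp_coev_eq hdT, hd.linearMap_comp_eq_zero, map_zero_left, AddMonoidHom.zero_apply]

/-- The quotient of `A × B` by `(g.prod (-d)).range` is the pushout of `g` and `d`. -/
theorem exists_map_eq_of_map_pushout_inl_eq_zero {F B : Type u} [AddCommGroup F] [Module R F]
    [AddCommGroup B] [Module R B] (g : F →ₗ[R] A) (d : F →ₗ[R] B) {x : BalancedTensor R N A}
    (hx : map R .id ((g.prod (-d)).range.mkQ ∘ₗ .inl R A B) x = 0) :
    ∃ z : BalancedTensor R N F, map R .id g z = x ∧ map R .id d z = 0 := by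
  have hx' : map R .id (g.prod (-d)).range.mkQ (map R .id (.inl R A B) x) = 0 := by
    rwa [map_map]
  obtain ⟨z, hz⟩ := (map_exact_right (LinearMap.exact_map_mkQ_range (g.prod (-d)))
    (Submodule.mkQ_surjective _) _).1 hx'
  refine ⟨z, ?_, ?_⟩
  · have := congrArg (map R .id (.fst R A B)) hz
    rwa [map_map, map_map, LinearMap.fst_comp_inl, LinearMap.fst_prod, LinearMap.id_comp,
      map_id_apply] at this
  · have := congrArg (map R .id (-LinearMap.snd R A B)) hz
    rwa [map_map, map_map, LinearMap.neg_comp, LinearMap.neg_comp, LinearMap.snd_prod,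
      LinearMap.snd_comp_inl, neg_neg, neg_zero, map_zero_right, LinearMap.id_comp] at this

theorem exists_map_eq_of_forall_map_eq_zero [Module.FinitePresentation Rᵐᵒᵖ P]
    {y : BalancedTensor R P A} {x : BalancedTensor R N A}
    (hyx : ∀ (S : ModuleCat.{u} R) (h : A →ₗ[R] S), map R .id h y = 0 → map R .id h x = 0) :
    ∃ φ : P →ₗ[Rᵐᵒᵖ] N, map R φ .id y = x := by
  obtain ⟨n, r, π, d, hπ, hd⟩ := Module.FinitePresentation.exists_fin' Rᵐᵒᵖ P
  obtain ⟨dT, hdT⟩ := exists_map_id_coev_eq_map_coev_id d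
  obtain ⟨g, rfl⟩ := exists_map_coev_eq_of_surjective hπ y
  let mk := (g.prod (-dT)).range.mkQ
  have hmk : (mk ∘ₗ .inl R A (Fin r → R)) ∘ₗ g = (mk ∘ₗ .inr R A (Fin r → R)) ∘ₗ dT :=
    LinearMap.ext fun v => (Submodule.Quotient.eq _).2 ⟨v, by simp⟩
  have hy : map R .id (mk ∘ₗ .inl R A (Fin r → R)) (map R π g (coev R n)) = 0 := by
    rw [map_map, hmk, map_comp_coev_eq hdT, LinearMap.comp_assoc, hd.linearMap_comp_eq_zero,
      LinearMap.comp_zero, map_zero_left, AddMonoidHom.zero_apply]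
  obtain ⟨z, hz, hz'⟩ := exists_map_eq_of_map_pushout_inl_eq_zero g dT (hyx (.of R _) _ hy)
  obtain ⟨f, rfl : map R f .id (coev R n) = z⟩ := map_coev_id_bijective.2 z
  rw [map_map, LinearMap.id_comp, LinearMap.comp_id] at hz hz'
  have hfd : f ∘ₗ d = 0 := map_coev_id_bijective.1 <| by
    change map R (f ∘ₗ d) .id (coev R r) = map R 0 .id (coev R r)
    rwa [map_zero_left, ← map_comp_coev_eq hdT, LinearMap.id_comp]
  let φ := d.range.liftQ f (LinearMap.range_le_ker_iff.2 hfd) ∘ₗ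
    (hd.linearEquivOfSurjective hπ).symm.toLinearMap
  have hφ : φ ∘ₗ π = f := LinearMap.ext fun v => by simp [φ]
  exact ⟨φ, by rw [map_map, hφ, LinearMap.id_comp, hz]⟩

end FinitePresentation

/-- A lift of `x ∈ M ⊗_R A` along a homomorphism to `M` from a finitely presented module. Only
quotients of `Fin n → R` are allowed, so that all lifts of `x` form a set in `Type u`. -/
structure FinitelyPresentedLift (x : BalancedTensor R M A) where
  rank : ℕ
  relations : Submodule Rᵐᵒᵖ (Fin rank → Rᵐᵒᵖ)
  relations_fg : relations.FG
  hom : ((Fin rank → Rᵐᵒᵖ) ⧸ relations) →ₗ[Rᵐᵒᵖ] M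
  elem : BalancedTensor R ((Fin rank → Rᵐᵒᵖ) ⧸ relations) A
  map_elem : map R hom .id elem = x

theorem FinitelyPresentedLift.finitePresentation {x : BalancedTensor R M A}
    (l : FinitelyPresentedLift x) :
    Module.FinitePresentation Rᵐᵒᵖ ((Fin l.rank → Rᵐᵒᵖ) ⧸ l.relations) :=
  Module.finitePresentation_of_free_of_surjective l.relations.mkQ l.relations.mkQ_surjective
    (by rw [Submodule.ker_mkQ]; exact l.relations_fg)

theorem exists_finitelyPresentedLift_map_eq_zero_of_free {F : Type u} [AddCommGroup F]
    [Module Rᵐᵒᵖ F] [Module.Free Rᵐᵒᵖ F] {π : F →ₗ[Rᵐᵒᵖ] M} (hπ : Function.Surjective π)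
    {x : BalancedTensor R M A} {h : A →ₗ[R] S} (hx : map R .id h x = 0) :
    ∃ l : FinitelyPresentedLift x, map R .id h l.elem = 0 := by
  obtain ⟨x, rfl⟩ := map_surjective (R := R) (g := (.id : A →ₗ[R] A)) hπ (fun a => ⟨a, rfl⟩) x
  rw [map_comm] at hx
  obtain ⟨y, hy⟩ := (map_exact_left π.exact_subtype_ker_map hπ _).1 hx
  obtain ⟨k, f, g, rfl⟩ := exists_eq_map_coev x
  obtain ⟨m, κ, t, rfl⟩ := exists_eq_map_coev y
  rw [map_map] at hy
  let ρ := π.ker.subtype ∘ₗ κ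
  obtain ⟨n, r, s, hrs⟩ := exists_comp_eq_on_of_fg
    ((Submodule.FG.of_finite (N := f.range)).sup (.of_finite (N := ρ.range)))
  have hf : s ∘ₗ r ∘ₗ f = f := LinearMap.ext fun v => hrs _ (Submodule.mem_sup_left ⟨v, rfl⟩)
  have hρ : s ∘ₗ r ∘ₗ ρ = ρ := LinearMap.ext fun v => hrs _ (Submodule.mem_sup_right ⟨v, rfl⟩)
  let L := (r ∘ₗ ρ).range
  have hL : L ≤ (π ∘ₗ s).ker := LinearMap.range_le_ker_iff.2 <| by
    rw [LinearMap.comp_assoc, hρ]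
    exact LinearMap.ext fun v => (κ v).2
  refine ⟨⟨n, L, .of_finite, L.liftQ (π ∘ₗ s) hL, map R (L.mkQ ∘ₗ r) .id (map R f g (coev R k)),
    ?_⟩, ?_⟩
  · calc _ = map R (π ∘ₗ s ∘ₗ r ∘ₗ f) g (coev R k) := by rw [map_map, map_map]; rfl
      _ = map R π .id (map R f g (coev R k)) := by rw [hf, map_map, LinearMap.id_comp]
  · calc _ = map R (L.mkQ ∘ₗ r) .id (map R .id h (map R f g (coev R k))) :=
          map_comm ..
      _ = map R (L.mkQ ∘ₗ r ∘ₗ ρ) t (coev R m) := by rw [← hy, map_map]; rfl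
      _ = 0 := by rw [LinearMap.range_mkQ_comp, map_zero_left, AddMonoidHom.zero_apply]

theorem exists_finitelyPresentedLift_map_eq_zero {x : BalancedTensor R M A} {h : A →ₗ[R] S}
    (hx : map R .id h x = 0) : ∃ l : FinitelyPresentedLift x, map R .id h l.elem = 0 :=
  exists_finitelyPresentedLift_map_eq_zero_of_free
    (Finsupp.linearCombination_id_surjective Rᵐᵒᵖ M) hx

end BalancedTensor

section Functors

variable {R : Type u} [Ring R] {F G : ModuleCat.{u} R ⥤ AddCommGrpCat.{u}}
  {A : ModuleCat.{u} R}

theorem IsMLFunctor.eq_zero_of_map_proj_eq_zero (hF : IsMLFunctor F) {I : Type u}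
    {S : I → ModuleCat.{u} R} {x : F.obj (.of R (∀ i, S i))}
    (hx : ∀ i, F.map (ModuleCat.ofHom (.proj i)) x = 0) : x = 0 :=
  hF.injective I S <| (funext hx).trans (map_zero (prodComparisonMap F S)).symm

theorem IsQsCh.exists_rep (hF : IsQsCh F) {I : Type u} [Preorder I] [IsDirectedOrder I]
    [Nonempty I] {K : I ⥤ ModuleCat.{u} R} {c : Cocone K} (hc : IsColimit c) (x : F.obj c.pt) :
    ∃ (i : I) (y : F.obj (K.obj i)), F.map (c.ι.app i) y = x :=
  have := hF.preservesDirectLimits I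
  Concrete.isColimit_exists_rep (K ⋙ F) (isColimitOfPreserves F hc) x

theorem IsQsCh.exists_of_rep_eq (hF : IsQsCh F) {I : Type u} [Preorder I] [IsDirectedOrder I]
    [Nonempty I] {K : I ⥤ ModuleCat.{u} R} {c : Cocone K} (hc : IsColimit c) {i j : I}
    (x : F.obj (K.obj i)) (y : F.obj (K.obj j))
    (hxy : F.map (c.ι.app i) x = F.map (c.ι.app j) y) :
    ∃ (k : I) (a : i ⟶ k) (b : j ⟶ k), F.map (K.map a) x = F.map (K.map b) y :=
  have := hF.preservesDirectLimits I
  Concrete.isColimit_exists_of_rep_eq (K ⋙ F) (isColimitOfPreserves F hc) x y hxy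

theorem injective_app_of_mono (i : G ⟶ F) [Mono i] (S : ModuleCat.{u} R) :
    Function.Injective (i.app S) :=
  (AddCommGrpCat.mono_iff_injective _).1 inferInstance

theorem IsQsCh.of_mono (hF : IsQsCh F) (i : G ⟶ F) [Mono i]
    (hG : ∀ (I : Type u) [Preorder I] [IsDirectedOrder I] [Nonempty I] {K : I ⥤ ModuleCat.{u} R}
      {c : Cocone K}, IsColimit c → ∀ x : G.obj c.pt, ∃ k y, x = G.map (c.ι.app k) y) :
    IsQsCh G where
  additive := ⟨fun {S T f g} => by
    have := hF.additive
    rw [← cancel_mono (i.app T), Preadditive.add_comp, i.naturality, i.naturality, i.naturality,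
      F.map_add, Preadditive.comp_add]⟩
  preservesDirectLimits I _ _ _ := ⟨fun {K} => ⟨fun {c} hc => by
    have : ReflectsColimitsOfShape I (forget AddCommGrpCat.{u}) :=
      reflectsColimitsOfShape_of_reflectsIsomorphisms
    refine ⟨isColimitOfReflects (forget AddCommGrpCat.{u}) <|
      Types.FilteredColimit.isColimitOf _ _ (hG I hc) fun k l x y hxy => ?_⟩
    have hxy' : F.map (c.ι.app k) (i.app _ x) = F.map (c.ι.app l) (i.app _ y) := by
      rw [← NatTrans.naturality_apply, ← NatTrans.naturality_apply]
      exact congrArg (i.app c.pt) hxy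
    obtain ⟨m, a, b, hab⟩ := hF.exists_of_rep_eq hc _ _ hxy'
    rw [← NatTrans.naturality_apply, ← NatTrans.naturality_apply] at hab
    exact ⟨m, a, b, injective_app_of_mono i _ hab⟩⟩⟩

theorem IsQsCh.exists_rep_fgModuleRepr (hF : IsQsCh F) {S : ModuleCat.{u} R} (s : F.obj S) :
    ∃ (A : FGModuleRepr R) (y : F.obj (.of R A)) (h : A →ₗ[R] S),
      F.map (ModuleCat.ofHom h) y = s := by
  classical
  let K := ModuleCat.directLimitDiagram _ (Module.fgSystem R S)
  let c : Cocone K := ModuleCat.directLimitCocone _ (Module.fgSystem R S)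
  let e : c.pt ≅ S := (Module.fgSystem.equiv R S).toModuleIso
  obtain ⟨N, y, hy⟩ := hF.exists_rep (ModuleCat.directLimitIsColimit ..) (F.map e.inv s)
  have : Module.Finite R N.1 := Module.Finite.iff_fg.2 N.2
  let ε : .of R (FGModuleRepr.ofFinite R N.1) ≅ K.obj N :=
    (FGModuleRepr.ofFiniteEquiv R N.1).toModuleIso
  refine ⟨_, F.map ε.inv y, (ε.hom ≫ c.ι.app N ≫ e.hom).hom, ?_⟩
  calc F.map (ε.hom ≫ c.ι.app N ≫ e.hom) (F.map ε.inv y) = F.map e.hom (F.map (c.ι.app N) y) := by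
        rw [← F.map_comp_apply, ← F.map_comp_apply, Iso.inv_hom_id_assoc]
    _ = F.map e.hom (F.map e.inv s) := congrArg _ hy
    _ = s := by rw [← F.map_comp_apply, e.inv_hom_id, F.map_id]; rfl

/-- The element `x` of `F(A)` generates `F`: every element of every `F(S)` is of the form `F(h)(x)`
for some `h : A ⟶ S`. -/
def Generates (x : F.obj A) : Prop :=
  ∀ S : ModuleCat.{u} R, Function.Surjective fun h : A ⟶ S => F.map h x

theorem IsFPFunctor.exists_generates (hF : IsFPFunctor F) :
    ∃ (A : ModuleCat.{u} R) (x : F.obj A), Generates x := by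
  -- The components of `x` run through all elements of `F` at finitely generated modules.
  let S (j : Σ A : FGModuleRepr R, F.obj (.of R A)) : ModuleCat.{u} R := .of R j.1
  obtain ⟨x, hx⟩ := (hF.bijective _ S).2 fun j => j.2
  refine ⟨_, x, fun T s => ?_⟩
  obtain ⟨A, y, h, rfl⟩ := hF.isQsCh.exists_rep_fgModuleRepr s
  refine ⟨ModuleCat.ofHom (.proj ⟨A, y⟩) ≫ ModuleCat.ofHom h, (F.map_comp_apply ..).trans ?_⟩
  exact congrArg (F.map (ModuleCat.ofHom h)) (congrFun hx ⟨A, y⟩)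

theorem Generates.hom_ext {x : F.obj A} (hx : Generates x) {v w : F ⟶ G}
    (hvw : v.app A x = w.app A x) : v = w := by
  ext S s
  obtain ⟨h, rfl⟩ := hx S s
  exact (NatTrans.naturality_apply v h x).trans
    ((congrArg (G.map h) hvw).trans (NatTrans.naturality_apply w h x).symm)

/-- The Yoneda homomorphism `h ↦ F(h)(x)`. -/
def evalHom [F.Additive] (x : F.obj A) (S : ModuleCat.{u} R) : (A ⟶ S) →+ F.obj S :=
  AddMonoidHom.mk' (fun h => F.map h x) fun g h => by rw [F.map_add]; rfl

theorem Generates.exists_hom [F.Additive] [G.Additive] {x : F.obj A} (hx : Generates x)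
    {y : G.obj A} (hxy : ∀ (S : ModuleCat.{u} R) (h : A ⟶ S), F.map h x = 0 → G.map h y = 0) :
    ∃ w : F ⟶ G, w.app A x = y := by
  have hker (S : ModuleCat.{u} R) : (evalHom x S).ker ≤ (evalHom y S).ker := hxy S
  let w (S : ModuleCat.{u} R) : F.obj S →+ G.obj S :=
    (evalHom x S).liftOfSurjective (hx S) ⟨evalHom y S, hker S⟩
  have hw (S : ModuleCat.{u} R) (h : A ⟶ S) : w S (F.map h x) = G.map h y :=
    AddMonoidHom.liftOfRightInverse_comp_apply _ _ (Function.rightInverse_surjInv (hx S))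
      ⟨evalHom y S, hker S⟩ h
  refine ⟨{
    app S := AddCommGrpCat.ofHom (w S)
    naturality S T g := AddCommGrpCat.hom_ext <| AddMonoidHom.ext fun s => ?_ }, ?_⟩
  · obtain ⟨h, rfl⟩ := hx S s
    calc w T (F.map g (F.map h x)) = w T (F.map (h ≫ g) x) :=
          congrArg (w T) (F.map_comp_apply h g x).symm
      _ = G.map (h ≫ g) y := hw T (h ≫ g)
      _ = G.map g (G.map h y) := G.map_comp_apply h g y
      _ = G.map g (w S (F.map h x)) := congrArg (G.map g) (hw S h).symm
  · calc w A x = w A (F.map (𝟙 A) x) := congrArg (w A) (F.map_id_apply A x).symm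
      _ = G.map (𝟙 A) y := hw A (𝟙 A)
      _ = y := G.map_id_apply A y

theorem epi_dualMap_iff (i : F ⟶ G) :
    Epi (dualMap i) ↔ ∀ (N : ModuleCat.{u} Rᵐᵒᵖ) (w : F ⟶ quasiCoherent N),
      ∃ W : G ⟶ quasiCoherent N, i ≫ W = w := by
  simp_rw [NatTrans.epi_iff_epi_app, AddCommGrpCat.epi_iff_surjective]
  rfl

section Generated

variable [F.Additive]

/-- The subfunctor `⟨x⟩` of `F` generated by an element `x` of `F(A)`: its value at `S` consists of
the elements `F(h)(x)` for `h : A ⟶ S`. -/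
def generated (x : F.obj A) : ModuleCat.{u} R ⥤ AddCommGrpCat.{u} where
  obj S := .of (evalHom x S).range
  map {S T} g := AddCommGrpCat.ofHom <| ((F.map g).hom.comp (AddSubgroup.subtype _)).codRestrict _
    (by rintro ⟨_, h, rfl⟩; exact ⟨h ≫ g, F.map_comp_apply h g x⟩)
  map_id S := AddCommGrpCat.hom_ext <| AddMonoidHom.ext fun y => Subtype.ext <|
    congrArg (fun f => f.hom y.1) (F.map_id S)
  map_comp g h := AddCommGrpCat.hom_ext <| AddMonoidHom.ext fun y => Subtype.ext <|
    F.map_comp_apply g h y.1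

variable (x : F.obj A)

/-- The element `F(h)(x)` of the value of `⟨x⟩` at `S`. -/
def generated.mk {S : ModuleCat.{u} R} (h : A ⟶ S) : (generated x).obj S := ⟨F.map h x, h, rfl⟩

theorem generated.mk_surjective (S : ModuleCat.{u} R) :
    Function.Surjective (generated.mk x (S := S)) := by
  rintro ⟨_, h, rfl⟩
  exact ⟨h, rfl⟩

theorem generated.map_mk {S T : ModuleCat.{u} R} (h : A ⟶ S) (g : S ⟶ T) :
    (generated x).map g (mk x h) = mk x (h ≫ g) :=
  Subtype.ext (F.map_comp_apply h g x).symm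

theorem generated.generates : Generates (mk x (𝟙 A)) := fun S y => by
  obtain ⟨h, rfl⟩ := mk_surjective x S y
  exact ⟨h, (map_mk x (𝟙 A) h).trans (congrArg (mk x) (Category.id_comp h))⟩

/-- The inclusion `⟨x⟩ ⟶ F`. -/
def generated.ι : generated x ⟶ F where
  app _ := AddCommGrpCat.ofHom (AddSubgroup.subtype _)

instance : Mono (generated.ι x) := by
  simp_rw [NatTrans.mono_iff_mono_app, AddCommGrpCat.mono_iff_injective]
  exact fun S => Subtype.val_injective

theorem exists_comp_ι_app_eq {n : ℕ} {I : Type u} [Preorder I] [IsDirectedOrder I] [Nonempty I]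
    {K : I ⥤ ModuleCat.{u} R} {c : Cocone K} (hc : IsColimit c)
    (h : ModuleCat.of R (Fin n → R) ⟶ c.pt) : ∃ k g, g ≫ c.ι.app k = h := by
  choose a y hy using fun i => Concrete.isColimit_exists_rep K hc (h (Pi.single i 1))
  obtain ⟨k, hk⟩ := (Set.finite_range a).bddAbove
  have hak (i : Fin n) : a i ≤ k := hk ⟨i, rfl⟩
  refine ⟨k, ModuleCat.ofHom (Fintype.linearCombination R fun i => K.map (homOfLE (hak i)) (y i)),
    ModuleCat.hom_ext <| LinearMap.pi_ext' fun i => LinearMap.ext_ring ?_⟩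
  simp [← hy]

theorem IsMLFunctor.isFPFunctor_generated (hF : IsMLFunctor F) {n : ℕ}
    (x : F.obj (.of R (Fin n → R))) : IsFPFunctor (generated x) where
  isQsCh := hF.isQsCh.of_mono (generated.ι x) fun I _ _ _ K c hc y => by
    obtain ⟨h, rfl⟩ := generated.mk_surjective x _ y
    obtain ⟨k, g, rfl⟩ := exists_comp_ι_app_eq hc h
    exact ⟨k, generated.mk x g, (generated.map_mk ..).symm⟩
  bijective I S := by
    refine ⟨(injective_iff_map_eq_zero _).2 fun y hy => ?_, fun y => ?_⟩
    · exact Subtype.ext <| hF.eq_zero_of_map_proj_eq_zero fun i =>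
        congrArg Subtype.val (congrFun hy i)
    · choose h hh using fun i => generated.mk_surjective x _ (y i)
      refine ⟨generated.mk x (ModuleCat.ofHom (.pi fun i => (h i).hom)), funext fun i => ?_⟩
      exact (generated.map_mk ..).trans (hh i)

end Generated

end Functors

section QuasiCoherent

open BalancedTensor

variable {R : Type u} [Ring R]

/-- The left `R`-module of additive maps from a right `R`-module `M` to an abelian group. -/
@[reducible] def rightModuleHomModule (M B : Type u) [AddCommGroup M] [Module Rᵐᵒᵖ M]
    [AddCommGroup B] : Module R (M →+ B) where
  smul r f := f.comp (DistribSMul.toAddMonoidHom M (MulOpposite.op r))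
  one_smul f := by ext m; exact congrArg f (one_smul _ m)
  mul_smul a b f := by ext m; exact congrArg f (mul_smul (MulOpposite.op b) (MulOpposite.op a) m)
  smul_zero r := rfl
  smul_add r f g := rfl
  add_smul a b f := by
    ext m
    exact (congrArg f (add_smul (MulOpposite.op a) (MulOpposite.op b) m)).trans (map_add f _ _)
  zero_smul f := by ext m; exact (congrArg f (zero_smul Rᵐᵒᵖ m)).trans (map_zero f)

/-- The value at `B` of the right adjoint of `S ↦ M ⊗_R S`. -/
def homObj (M : ModuleCat.{u} Rᵐᵒᵖ) (B : AddCommGrpCat.{u}) : ModuleCat.{u} R :=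
  letI := rightModuleHomModule (R := R) M B
  .of R (M →+ B)

/-- The tensor-hom adjunction `Hom(M ⊗_R S, B) ≃ Hom_R(S, Hom(M, B))`. -/
noncomputable def tensorHomEquiv (M : ModuleCat.{u} Rᵐᵒᵖ) (S : ModuleCat.{u} R)
    (B : AddCommGrpCat.{u}) : ((quasiCoherent M).obj S ⟶ B) ≃ (S ⟶ homObj M B) :=
  letI := rightModuleHomModule (R := R) M B
  { toFun := fun f => ModuleCat.ofHom
      { toFun := fun s => f.hom.comp ((tmulHom R M S).flip s)
        map_add' := fun s t => by
          rw [map_add]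
          exact map_add (AddMonoidHom.compHom f.hom) _ _
        map_smul' := fun r s => by
          ext m
          exact congrArg f.hom (tmul_balanced R m r s).symm }
    invFun := fun g => AddCommGrpCat.ofHom
      (lift (AddMonoidHom.flip (show S →+ (M →+ B) from g.hom.toAddMonoidHom)) fun m r s =>
        (DFunLike.congr_fun (show (show M →+ B from g.hom (r • s)) = _ from g.hom.map_smul r s)
          m).symm)
    left_inv := fun f => by
      ext1
      exact addHom_ext R fun _ _ => rfl
    right_inv := fun g => rfl }

instance (M : ModuleCat.{u} Rᵐᵒᵖ) : (quasiCoherent M).IsLeftAdjoint :=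
  ⟨_, ⟨Adjunction.adjunctionOfEquivRight (F := quasiCoherent M) (G_obj := homObj M)
    (e := tensorHomEquiv M) (he := fun _ _ _ _ _ => rfl)⟩⟩

theorem isQsCh_quasiCoherent (M : ModuleCat.{u} Rᵐᵒᵖ) : IsQsCh (quasiCoherent M) where
  additive := inferInstance
  preservesDirectLimits _ _ _ _ :=
    (Adjunction.ofIsLeftAdjoint (quasiCoherent M)).leftAdjoint_preservesColimits.1

theorem BalancedTensor.map_toSpanSingleton {M S : Type u} [AddCommGroup M] [Module Rᵐᵒᵖ M]
    [AddCommGroup S] [Module R S] (s : S) (y : BalancedTensor R M R) :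
    map R .id (LinearMap.toSpanSingleton R S s) y = tmul R (rid y) s := by
  induction y using induction_on with
  | tmul m r => exact (tmul_balanced R m r s).symm
  | add x y hx hy =>
    rw [map_add, map_add, hx, hy]
    exact (map_add ((tmulHom R M S).flip s) _ _).symm

theorem quasiCoherent_hom_app_tmul {M N : ModuleCat.{u} Rᵐᵒᵖ}
    (W : quasiCoherent M ⟶ quasiCoherent N) (S : ModuleCat.{u} R) (m : M) (s : S) :
    W.app S (tmul R m s) = tmul R (rid (W.app (.of R R) (tmul R m 1))) s := by
  have h := NatTrans.naturality_apply W (ModuleCat.ofHom (LinearMap.toSpanSingleton R S s))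
    (tmul R m 1)
  refine Eq.trans ?_ (h.trans (map_toSpanSingleton s _))
  exact congrArg (W.app S) (congrArg (tmul R m) (one_smul R s).symm)

instance : (quasiCoherentFunctor R).Full where
  map_surjective {M N} W := by
    let ρ : M →+ N := (rid.comp (W.app (.of R R)).hom).comp ((tmulHom R M R).flip 1)
    have hρ (a : Rᵐᵒᵖ) (m : M) : ρ (a • m) = a • ρ m := calc
      ρ (a • m) = rid (W.app (.of R R) (tmul R m a.unop)) :=
        congrArg (fun x => rid (W.app (.of R R) x)) <|
          (tmul_balanced R m a.unop 1).trans (congrArg (tmul R m) (mul_one a.unop))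
      _ = a • ρ m := congrArg rid (quasiCoherent_hom_app_tmul W (.of R R) m a.unop)
    refine ⟨ModuleCat.ofHom { ρ with map_smul' := hρ }, ?_⟩
    ext S : 2
    exact AddCommGrpCat.hom_ext <| addHom_ext R fun m s =>
      (quasiCoherent_hom_app_tmul W S m s).symm

end QuasiCoherent

section StrictMittagLeffler

open BalancedTensor

variable {R : Type u} [Ring R]

theorem BalancedTensor.exists_fg_map_eq_self {M S : Type u} [AddCommGroup M] [Module Rᵐᵒᵖ M]
    [AddCommGroup S] [Module R S] (x : BalancedTensor R M S) :
    ∃ N : Submodule Rᵐᵒᵖ M, N.FG ∧ ∀ e : M →ₗ[Rᵐᵒᵖ] M,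
      e ∘ₗ N.subtype = N.subtype → map R e .id x = x := by
  obtain ⟨n, m, s, rfl⟩ := exists_eq_map_coev x
  refine ⟨m.range, .of_finite, fun e he => ?_⟩
  have hem : e ∘ₗ m = m := LinearMap.ext fun v => LinearMap.congr_fun he ⟨m v, v, rfl⟩
  rw [map_map, hem, LinearMap.id_comp]

theorem IsStrictMittagLeffler.exists_map_map_eq {M S : Type u} [AddCommGroup M] [Module Rᵐᵒᵖ M]
    (hM : IsStrictMittagLeffler Rᵐᵒᵖ M) [AddCommGroup S] [Module R S] (x : BalancedTensor R M S) :
    ∃ (P : ModuleCat.{u} Rᵐᵒᵖ) (f : M →ₗ[Rᵐᵒᵖ] P) (g : P →ₗ[Rᵐᵒᵖ] M),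
      Module.FinitePresentation Rᵐᵒᵖ P ∧ map R g .id (map R f .id x) = x := by
  obtain ⟨N, hN, hNx⟩ := exists_fg_map_eq_self x
  obtain ⟨P, f, g, hP, hgf⟩ := hM N hN
  exact ⟨P, f, g, hP, (map_map ..).trans (hNx (g ∘ₗ f) hgf)⟩

theorem IsStrictMittagLeffler.isMLFunctor {M : ModuleCat.{u} Rᵐᵒᵖ}
    (hM : IsStrictMittagLeffler Rᵐᵒᵖ M) : IsMLFunctor (quasiCoherent M) where
  isQsCh := isQsCh_quasiCoherent M
  injective I S := (injective_iff_map_eq_zero _).2 fun (x : BalancedTensor R M (∀ i, S i)) hx => by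
    obtain ⟨P, f, g, hP, hgf⟩ := hM.exists_map_map_eq x
    have hfx : map R f .id x = 0 := BalancedTensor.eq_zero_of_map_proj_eq_zero fun i => by
      rw [map_comm, show map R .id (.proj i) x = 0 from congrFun hx i, map_zero]
    exact hgf.symm.trans ((congrArg (map R g .id) hfx).trans (map_zero _))

theorem IsStrictMittagLeffler.exists_comp_eq {M N : ModuleCat.{u} Rᵐᵒᵖ}
    (hM : IsStrictMittagLeffler Rᵐᵒᵖ M) {F : ModuleCat.{u} R ⥤ AddCommGrpCat.{u}}
    (hF : IsFPFunctor F) (i : F ⟶ quasiCoherent M) [Mono i] (w : F ⟶ quasiCoherent N) :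
    ∃ W : quasiCoherent M ⟶ quasiCoherent N, i ≫ W = w := by
  obtain ⟨A, x, hx⟩ := hF.exists_generates
  obtain ⟨P, f, g, hP, hgf⟩ := hM.exists_map_map_eq (i.app A x)
  have hkill (S : ModuleCat.{u} R) (h : A →ₗ[R] S)
      (h₀ : map R .id h (map R f .id (i.app A x)) = 0) : map R .id h (w.app A x) = 0 := by
    have hix : map R .id h (i.app A x) = 0 := by
      rw [← hgf, map_comm, h₀, map_zero]
    have hFx : F.map (ModuleCat.ofHom h) x = 0 := injective_app_of_mono i S <|
      (NatTrans.naturality_apply i _ x).trans (hix.trans (map_zero (i.app S).hom).symm)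
    exact (NatTrans.naturality_apply w (ModuleCat.ofHom h) x).symm.trans
      ((congrArg (w.app S) hFx).trans (map_zero (w.app S).hom))
  obtain ⟨φ, hφ⟩ := exists_map_eq_of_forall_map_eq_zero hkill
  have hφf : map R (φ ∘ₗ f) .id (i.app A x) = w.app A x :=
    (map_map f φ .id .id (i.app A x)).symm.trans hφ
  exact ⟨(quasiCoherentFunctor R).map (ModuleCat.ofHom (φ ∘ₗ f)), hx.hom_ext hφf⟩

theorem IsStrictMittagLeffler.isSMLFunctor {M : ModuleCat.{u} Rᵐᵒᵖ}
    (hM : IsStrictMittagLeffler Rᵐᵒᵖ M) : IsSMLFunctor (quasiCoherent M) where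
  isML := hM.isMLFunctor
  epi_dual _ i hF _ := (epi_dualMap_iff i).2 fun _ => hM.exists_comp_eq hF i

/-- Otherwise every lift of `x` is detected by some `h` that kills `x`; the product of these `h`
kills `x` by the Mittag-Leffler property, hence kills some lift, which is absurd. -/
theorem IsMLFunctor.exists_finitelyPresentedLift {M : ModuleCat.{u} Rᵐᵒᵖ}
    (hM : IsMLFunctor (quasiCoherent M)) {A : Type u} [AddCommGroup A] [Module R A]
    (x : BalancedTensor R M A) : ∃ l : FinitelyPresentedLift x,
      ∀ (S : ModuleCat.{u} R) (h : A →ₗ[R] S), map R .id h x = 0 → map R .id h l.elem = 0 := by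
  by_contra! H
  choose S h hx hl using H
  have hpi : map R .id (LinearMap.pi h) x = 0 :=
    hM.eq_zero_of_map_proj_eq_zero (x := map R .id (LinearMap.pi h) x) fun l => by
      change map R .id (.proj l) (map R .id (LinearMap.pi h) x) = 0
      rw [map_map, LinearMap.proj_pi, LinearMap.id_comp, hx]
  obtain ⟨l, hl₀⟩ := exists_finitelyPresentedLift_map_eq_zero hpi
  have hl₁ := congrArg (map R .id (.proj (φ := fun l => S l) l)) hl₀
  rw [map_map, LinearMap.proj_pi, LinearMap.id_comp, map_zero] at hl₁
  exact hl l hl₁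

theorem IsSMLFunctor.exists_map_map_eq {M : ModuleCat.{u} Rᵐᵒᵖ}
    (hM : IsSMLFunctor (quasiCoherent M)) {n : ℕ} (x : BalancedTensor R M (Fin n → R)) :
    ∃ (P : ModuleCat.{u} Rᵐᵒᵖ) (f : M →ₗ[Rᵐᵒᵖ] P) (g : P →ₗ[Rᵐᵒᵖ] M),
      Module.FinitePresentation Rᵐᵒᵖ P ∧ map R g .id (map R f .id x) = x := by
  obtain ⟨l, hl⟩ := hM.isML.exists_finitelyPresentedLift x
  let x' : (quasiCoherent M).obj (.of R (Fin n → R)) := x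
  have hF : IsFPFunctor (generated x') := hM.isML.isFPFunctor_generated x'
  have := hF.isQsCh.additive
  have hx' : (generated.ι x').app _ (generated.mk x' (𝟙 _)) = x' :=
    (quasiCoherent M).map_id_apply _ x'
  obtain ⟨w, hw⟩ := (generated.generates x').exists_hom (G := quasiCoherent (.of Rᵐᵒᵖ _))
    (y := l.elem) fun S h hmk => hl S h.hom <| by
      have := congrArg ((generated.ι x').app S) hmk
      rw [NatTrans.naturality_apply, hx', map_zero] at this
      exact this
  obtain ⟨W, rfl⟩ := (epi_dualMap_iff _).1 (hM.epi_dual _ (generated.ι _) hF inferInstance) _ w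
  obtain ⟨f, rfl⟩ := (quasiCoherentFunctor R).map_surjective W
  refine ⟨_, f.hom, l.hom, l.finitePresentation, ?_⟩
  have hfx : map R f.hom .id x = l.elem := by
    rw [← hw]
    exact congrArg (((quasiCoherentFunctor R).map f).app _) hx'.symm
  rw [hfx, l.map_elem]

theorem IsSMLFunctor.isStrictMittagLeffler {M : ModuleCat.{u} Rᵐᵒᵖ}
    (hM : IsSMLFunctor (quasiCoherent M)) : IsStrictMittagLeffler Rᵐᵒᵖ M := by
  intro N hN
  have : Module.Finite Rᵐᵒᵖ N := Module.Finite.iff_fg.2 hN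
  obtain ⟨n, π, hπ⟩ := Module.Finite.exists_fin' Rᵐᵒᵖ N
  obtain ⟨P, f, g, hP, hgf⟩ := hM.exists_map_map_eq (map R (N.subtype ∘ₗ π) .id (coev R n))
  refine ⟨P, f, g, hP, (LinearMap.cancel_right hπ).1 (map_coev_id_bijective.1 ?_)⟩
  rw [map_map, map_map, LinearMap.id_comp] at hgf
  exact hgf

theorem IsPureMono.injective {M M' : Type u} [AddCommGroup M] [Module Rᵐᵒᵖ M] [AddCommGroup M']
    [Module Rᵐᵒᵖ M'] {f : M →ₗ[Rᵐᵒᵖ] M'} (hf : IsPureMono R f) : Function.Injective f := by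
  intro x y hxy
  have h : tmul R x (1 : R) = tmul R y 1 := hf (.of R R) (congrArg (tmul R · (1 : R)) hxy)
  simpa using congrArg rid h

theorem IsStrictMittagLeffler.exists_isPureMono {M : Type u} [AddCommGroup M] [Module Rᵐᵒᵖ M]
    (hM : IsStrictMittagLeffler Rᵐᵒᵖ M) :
    ∃ (J : Type u) (P : J → ModuleCat.{u} Rᵐᵒᵖ) (f : M →ₗ[Rᵐᵒᵖ] (∀ j, P j)),
      (∀ j, Module.FinitePresentation Rᵐᵒᵖ (P j)) ∧ IsPureMono R f := by
  choose P f g hP hgf using hM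
  let J := {N : Submodule Rᵐᵒᵖ M // N.FG}
  refine ⟨J, fun N => P N.1 N.2, .pi fun N => f N.1 N.2, fun N => hP N.1 N.2, fun S => ?_⟩
  refine (injective_iff_map_eq_zero _).2 fun x hx => ?_
  obtain ⟨N, hN, hNx⟩ := exists_fg_map_eq_self x
  have hfx : map R (f N hN) .id x = 0 := by
    have := congrArg (map R (.proj (φ := fun N : J => P N.1 N.2) ⟨N, hN⟩) .id) hx
    rwa [map_map, LinearMap.proj_pi, LinearMap.id_comp, map_zero] at this
  calc x = map R (g N hN ∘ₗ f N hN) .id x := (hNx (g N hN ∘ₗ f N hN) (hgf N hN)).symm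
    _ = map R (g N hN) .id (map R (f N hN) .id x) := by rw [map_map, LinearMap.id_comp]
    _ = 0 := by rw [hfx, map_zero]

end StrictMittagLeffler

theorem mainTheorem4 (R : Type u) [Ring R] (M : Type u) [AddCommGroup M] [Module Rᵐᵒᵖ M] :
    (IsStrictMittagLeffler Rᵐᵒᵖ M ↔
      IsSMLFunctor (R := R) (quasiCoherent (ModuleCat.of Rᵐᵒᵖ M))) ∧
    (IsStrictMittagLeffler Rᵐᵒᵖ M →
      ∃ (J : Type u) (P : J → ModuleCat.{u} Rᵐᵒᵖ) (f : M →ₗ[Rᵐᵒᵖ] (∀ j, P j)),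
        (∀ j, Module.FinitePresentation Rᵐᵒᵖ (P j)) ∧ Function.Injective f ∧
          IsPureMono R f) := by
  refine ⟨⟨fun hM => IsStrictMittagLeffler.isSMLFunctor (M := .of Rᵐᵒᵖ M) hM,
    fun hM => hM.isStrictMittagLeffler⟩, fun hM => ?_⟩
  obtain ⟨J, P, f, hP, hf⟩ := hM.exists_isPureMono
  exact ⟨J, P, f, hP, hf.injective, hf⟩
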